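/- Let $\mathbb{N}=\{1,2,3,\dots\}$, let $\mathbb{K}$ be $\mathbb{R}$ or $\mathbb{C}$ and let $X$ be a Banach space over $\mathbb{K}$. For nonempty finite $E,F\subset\mathbb{N}$ write $E<F$ if $\max E<\min F$. Fix, for every limit ordinal $\xi<\omega_1$, an arbitrary strictly increasing sequence of ordinals $(\xi_n)_{n\ge 1}$ with $\sup_n\xi_n=\xi$. The Schreier families $\mathcal{S}_\xi$, $\xi<\omega_1$, are the sets of finite subsets of $\mathbb{N}$ given by $\mathcal{S}_0=\{\varnothing\}\cup\{\{n\}:n\in\mathbb{N}\}$, $$\mathcal{S}_{\xi+1}=\{\varnothing\}\cup\Bigl\{\bigcup_{i=1}^nE_i:\ E_1<\dots<E_n,\ \varnothing\ne E_i\in\mathcal{S}_\xi,\ n\le\min E_1\Bigr\},$$ and $\mathcal{S}_\xi=\{E:\ \exists n\in\mathbb{N},\ E\in\mathcal{S}_{\xi_n}\text{ and } n\le m\text{ for all } m\in E\}$ for a limit ordinal $\xi$. For $0<\xi<\omega_1$, a sequence $(x_n)_{n\ge1}$ in $X$ is an $\ell_1^\xi$-spreading model if $$0<\inf\Bigl\{\Bigl\|\sum_{n\in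 E}a_nx_n\Bigr\|:\ E\in\mathcal{S}_\xi,\ a_n\in\mathbb{K},\ \sum_{n\in E}|a_n|=1\Bigr\}.$$ A sequence $(x_n)_{n\ge1}$ in $X$ is $\xi$-weakly convergent to $x\in X$ if: it converges to $x$ in norm, when $\xi=0$; it converges weakly to $x$ and no subsequence of $(x_n-x)_{n\ge1}$ is an $\ell_1^\xi$-spreading model, when $0<\xi<\omega_1$; it converges weakly to $x$, when $\xi=\omega_1$. A subset $K$ of $X$ is $\xi$-weakly precompact (respectively, $\xi$-weakly compact) if every sequence in $K$ has a subsequence which is $\xi$-weakly convergent to some member of $X$ (respectively, of $K$). Proposition. For every ordinal $0\le\xi\le\omega_1$ and every subset $K$ of $X$ (not assumed convex), $K$ is $\xi$-weakly precompact if and only if its weak closure $\overline{K}^{\mathrm{weak}}$ is $\xi$-weakly compact. -/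

import Mathlib

open Filter Topology
open scoped Ordinal

namespace XiWeak

/-- A choice, for every countable limit ordinal `ξ`, of a sequence of ordinals `ξ_n ↑ ξ`.
Sequences and finite sets are indexed by the positive integers `ℕ+ = {1, 2, 3, …}`. -/
def IsFundamentalChoice (c : Ordinal.{0} → ℕ+ → Ordinal.{0}) : Prop :=
  ∀ ξ : Ordinal.{0}, Order.IsSuccLimit ξ → ξ < ω₁ →
    StrictMono (c ξ) ∧ IsLUB (Set.range (c ξ)) ξ

/-- `𝒮_0`: the empty set and the singletons. -/
def schreierZero : Set (Finset ℕ+) :=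
  {E | E = ∅ ∨ ∃ n : ℕ+, E = {n}}

/-- `𝒮_{ξ+1}` from `F = 𝒮_ξ`: the empty set and the unions `E_1 ∪ ⋯ ∪ E_n` of nonempty
successive members `E_1 < ⋯ < E_n` of `F` with `n ≤ min E_1`. -/
def schreierSucc (F : Set (Finset ℕ+)) : Set (Finset ℕ+) :=
  {E | E = ∅ ∨ ∃ (n : ℕ) (G : Fin n → Finset ℕ+),
    (∀ i, G i ∈ F ∧ (G i).Nonempty) ∧
    (∀ i j, i < j → ∀ a ∈ G i, ∀ b ∈ G j, a < b) ∧
    (∀ i, ∀ a ∈ G i, n ≤ (a : ℕ)) ∧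
    E = Finset.univ.biUnion G}

/-- The Schreier families `𝒮_ξ` built from the choice `c` of sequences `c ξ n ↑ ξ` at limit
ordinals: `𝒮_ξ = {E : ∃ n, n ≤ E ∈ 𝒮_{c ξ n}}` for a limit ordinal `ξ`. (The proof `h` that
`c ξ n < ξ` only makes the recursion well founded; it exists whenever `c` is a fundamental choice
and `ξ < ω₁`.) -/
noncomputable def schreier (c : Ordinal.{0} → ℕ+ → Ordinal.{0}) (ξ : Ordinal.{0}) :
    Set (Finset ℕ+) :=
  Ordinal.limitRecOn (motive := fun _ => Set (Finset ℕ+)) ξ schreierZero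
    (fun _ F => schreierSucc F)
    (fun η _ S => {E | ∃ (n : ℕ+) (h : c η n < η), (∀ a ∈ E, n ≤ a) ∧ E ∈ S (c η n) h})

theorem schreier_zero (c : Ordinal.{0} → ℕ+ → Ordinal.{0}) : schreier c 0 = schreierZero := by
  simp [schreier]

theorem schreier_add_one (c : Ordinal.{0} → ℕ+ → Ordinal.{0}) (ξ : Ordinal.{0}) :
    schreier c (ξ + 1) = schreierSucc (schreier c ξ) := by
  simp only [schreier, Ordinal.limitRecOn_add_one]

theorem schreier_limit {c : Ordinal.{0} → ℕ+ → Ordinal.{0}} (hc : IsFundamentalChoice c)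
    {ξ : Ordinal.{0}} (hξ : Order.IsSuccLimit ξ) (hξ' : ξ < ω₁) :
    schreier c ξ = {E | ∃ n : ℕ+, (∀ a ∈ E, n ≤ a) ∧ E ∈ schreier c (c ξ n)} := by
  obtain ⟨hm, hl⟩ := hc ξ hξ hξ'
  have hlt : ∀ n, c ξ n < ξ := fun n =>
    (hm (PNat.lt_add_right n 1)).trans_le (hl.1 ⟨n + 1, rfl⟩)
  ext E
  rw [schreier, Ordinal.limitRecOn_limit _ _ _ _ hξ]
  exact ⟨fun ⟨n, _, h1, h2⟩ => ⟨n, h1, h2⟩, fun ⟨n, h1, h2⟩ => ⟨n, hlt n, h1, h2⟩⟩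

section Banach

variable (𝕜 : Type*) [RCLike 𝕜] {X : Type*} [NormedAddCommGroup X] [NormedSpace 𝕜 X]

/-- `(x_n)` is an `ℓ₁`-spreading model with respect to the family `S` of finite sets:
`0 < inf {‖∑_{n ∈ E} a_n x_n‖ : E ∈ S, ∑_{n ∈ E} |a_n| = 1}`. -/
def IsSpreadingModel (S : Set (Finset ℕ+)) (x : ℕ+ → X) : Prop :=
  ∃ δ : ℝ, 0 < δ ∧ ∀ E ∈ S, ∀ a : ℕ+ → 𝕜,
    ∑ n ∈ E, ‖a n‖ = 1 → δ ≤ ‖∑ n ∈ E, a n • x n‖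

/-- Convergence of a sequence in the weak topology. -/
def WeaklyConvergesTo (x : ℕ+ → X) (y : X) : Prop :=
  Tendsto (fun n => toWeakSpace 𝕜 X (x n)) atTop (𝓝 (toWeakSpace 𝕜 X y))

/-- `(x_n)` is `ξ`-weakly convergent to `y` (`0 ≤ ξ ≤ ω₁`): norm convergent if `ξ = 0`, weakly
convergent if `ξ = ω₁`, and, if `0 < ξ < ω₁`, weakly convergent and such that no subsequence of
`(x_n - y)` is an `ℓ₁^ξ`-spreading model. -/
def XiWeaklyConvergesTo (c : Ordinal.{0} → ℕ+ → Ordinal.{0}) (ξ : Ordinal.{0})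
    (x : ℕ+ → X) (y : X) : Prop :=
  (ξ = 0 → Tendsto x atTop (𝓝 y)) ∧
  (0 < ξ → WeaklyConvergesTo 𝕜 x y) ∧
  (0 < ξ → ξ < ω₁ → ∀ k : ℕ+ → ℕ+, StrictMono k →
    ¬ IsSpreadingModel 𝕜 (schreier c ξ) (fun n => x (k n) - y))

/-- Every sequence in `K` has a subsequence `ξ`-weakly convergent to some member of `X`. -/
def IsXiWeaklyPrecompact (c : Ordinal.{0} → ℕ+ → Ordinal.{0}) (ξ : Ordinal.{0})
    (K : Set X) : Prop :=
  ∀ x : ℕ+ → X, (∀ n, x n ∈ K) → ∃ k : ℕ+ → ℕ+, StrictMono k ∧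
    ∃ y : X, XiWeaklyConvergesTo 𝕜 c ξ (fun n => x (k n)) y

/-- Every sequence in `K` has a subsequence `ξ`-weakly convergent to some member of `K`. -/
def IsXiWeaklyCompact (c : Ordinal.{0} → ℕ+ → Ordinal.{0}) (ξ : Ordinal.{0})
    (K : Set X) : Prop :=
  ∀ x : ℕ+ → X, (∀ n, x n ∈ K) → ∃ k : ℕ+ → ℕ+, StrictMono k ∧
    ∃ y ∈ K, XiWeaklyConvergesTo 𝕜 c ξ (fun n => x (k n)) y

/-- The closure of `K` in the weak topology of `X`. -/
def weakClosure (K : Set X) : Set X :=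
  toWeakSpace 𝕜 X ⁻¹' closure (toWeakSpace 𝕜 X '' K)

end Banach

end XiWeak

/-! The inclusion of `K` in its weak closure gives one direction. For the other, the case `ξ = 0` is
norm compactness, and for `0 < ξ` Eberlein–Šmulian
(`IsRelativelyWeaklyCountablyCompact.exists_subseq`) extracts from any sequence in the weak closure
a subsequence converging weakly to some `y`, which settles `ξ = ω₁`.

For `0 < ξ < ω₁` it remains to show that a spreading model `x n - y` with `x n` in the weak closure
forces one built from points of `K`. The difficulty is that a point of `K` approximates `x n` only
against finitely many functionals, while the lower estimate involves infinitely many sets `E`. Each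
`E` in the family has a functional of norm at most `1/δ` equal to `1` on `x n - y`, `n ∈ E`. As the
family is hereditary and compact, these can be rechosen so that `f (insert n s)` tends weak-star to
`f s` along an ultrafilter (`exists_coherent_functionals`). Finitely many constraints per step then
produce `w j ∈ K` almost biorthogonal to all the functionals (`exists_almost_biorthogonal`), and
spreading transfers the lower `ℓ₁`-estimate to every weakly convergent subsequence of `w`
(`IsSpreadingModel.of_almost_biorthogonal`). -/

namespace XiWeak

/-! ### Schreier families are hereditary, spreading and compact. -/

/-- A family of finite sets is hereditary if it contains the subsets of its members. -/
def IsHereditary (S : Set (Finset ℕ+)) : Prop :=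
  ∀ E ∈ S, ∀ F ⊆ E, F ∈ S

/-- A family of finite sets is spreading if it is stable under strictly increasing maps. -/
def IsSpreading (S : Set (Finset ℕ+)) : Prop :=
  ∀ k : ℕ+ → ℕ+, StrictMono k → ∀ E ∈ S, E.image k ∈ S

/-- A family of finite sets is compact if no infinite set has all its finite subsets in it. -/
def IsCompactFamily (S : Set (Finset ℕ+)) : Prop :=
  ∀ M : Set ℕ+, (∀ E : Finset ℕ+, ↑E ⊆ M → E ∈ S) → M.Finite

theorem PNat.le_apply_of_strictMono {k : ℕ+ → ℕ+} (hk : StrictMono k) (n : ℕ+) : n ≤ k n :=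
  hk.id_le n

theorem PNat.tendsto_atTop_of_strictMono {k : ℕ+ → ℕ+} (hk : StrictMono k) :
    Tendsto k atTop atTop :=
  tendsto_atTop_mono (PNat.le_apply_of_strictMono hk) tendsto_id

theorem isHereditary_schreierZero : IsHereditary schreierZero := by
  rintro E (rfl | ⟨n, rfl⟩) F hF
  · exact Or.inl (Finset.subset_empty.1 hF)
  · rcases Finset.subset_singleton_iff.1 hF with h | h
    · exact Or.inl h
    · exact Or.inr ⟨n, h⟩

theorem isSpreading_schreierZero : IsSpreading schreierZero := by
  rintro k - E (rfl | ⟨n, rfl⟩)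
  · exact Or.inl rfl
  · exact Or.inr ⟨k n, by simp⟩

theorem isCompactFamily_schreierZero : IsCompactFamily schreierZero := by
  intro M hM
  refine Set.Subsingleton.finite fun a ha b hb => ?_
  have h := hM {a, b} (by simp [Set.insert_subset_iff, ha, hb])
  rcases h with h | ⟨n, h⟩
  · simp at h
  · have h1 : a ∈ ({n} : Finset ℕ+) := h ▸ by simp
    have h2 : b ∈ ({n} : Finset ℕ+) := h ▸ by simp
    rw [Finset.mem_singleton.1 h1, Finset.mem_singleton.1 h2]

theorem IsHereditary.schreierSucc {S : Set (Finset ℕ+)} (hS : IsHereditary S) :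
    IsHereditary (schreierSucc S) := by
  classical
  rintro E (rfl | ⟨n, G, hG, hlt, hn, rfl⟩) F hF
  · exact Or.inl (Finset.subset_empty.1 hF)
  · right
    -- Pieces that miss `F` are dropped and the others renumbered in order; the number of pieces can
    -- only decrease, so it stays below every element.
    set I : Finset (Fin n) := Finset.univ.filter fun i => (G i ∩ F).Nonempty with hI
    set e := I.orderEmbOfFin rfl
    refine ⟨I.card, fun j => G (e j) ∩ F, fun j => ⟨?_, ?_⟩, ?_, ?_, ?_⟩
    · exact hS _ (hG _).1 _ Finset.inter_subset_left
    · exact (Finset.mem_filter.1 (I.orderEmbOfFin_mem rfl j)).2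
    · intro i j hij a ha b hb
      exact hlt _ _ (e.strictMono hij) a (Finset.mem_inter.1 ha).1 b (Finset.mem_inter.1 hb).1
    · intro i a ha
      refine le_trans ?_ (hn _ a (Finset.mem_inter.1 ha).1)
      simpa using I.card_le_univ
    · ext a
      simp only [Finset.mem_biUnion, Finset.mem_univ, true_and, Finset.mem_inter]
      constructor
      · intro ha
        obtain ⟨i, -, hi⟩ := Finset.mem_biUnion.1 (hF ha)
        have : i ∈ Set.range e := by
          rw [Finset.range_orderEmbOfFin]
          exact Finset.mem_coe.2 (Finset.mem_filter.2
            ⟨Finset.mem_univ _, a, Finset.mem_inter.2 ⟨hi, ha⟩⟩)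
        obtain ⟨j, rfl⟩ := this
        exact ⟨j, hi, ha⟩
      · rintro ⟨j, -, ha⟩
        exact ha

theorem IsSpreading.schreierSucc {S : Set (Finset ℕ+)} (hS : IsSpreading S) :
    IsSpreading (schreierSucc S) := by
  rintro k hk E (rfl | ⟨n, G, hG, hlt, hn, rfl⟩)
  · exact Or.inl rfl
  · refine Or.inr ⟨n, fun i => (G i).image k, fun i => ⟨hS k hk _ (hG i).1, (hG i).2.image k⟩,
      ?_, ?_, ?_⟩
    · intro i j hij a ha b hb
      obtain ⟨a, ha', rfl⟩ := Finset.mem_image.1 ha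
      obtain ⟨b, hb', rfl⟩ := Finset.mem_image.1 hb
      exact hk (hlt i j hij a ha' b hb')
    · intro i a ha
      obtain ⟨a, ha', rfl⟩ := Finset.mem_image.1 ha
      exact (hn i a ha').trans (PNat.coe_le_coe _ _ |>.2 (PNat.le_apply_of_strictMono hk a))
    · ext a
      simp only [Finset.mem_image, Finset.mem_biUnion, Finset.mem_univ, true_and]
      constructor
      · rintro ⟨b, ⟨i, hi⟩, rfl⟩
        exact ⟨i, b, hi, rfl⟩
      · rintro ⟨i, b, hi, rfl⟩
        exact ⟨b, ⟨i, hi⟩, rfl⟩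

/-- An ultrafilter selects one of finitely many alternatives. -/
theorem exists_eventually_of_finite {α ι : Type*} (U : Ultrafilter α) {t : Set ι} (ht : t.Finite)
    {p : ι → α → Prop} (h : ∀ᶠ a in (U : Filter α), ∃ i ∈ t, p i a) :
    ∃ i ∈ t, ∀ᶠ a in (U : Filter α), p i a := by
  have : (⋃ i ∈ t, {a | p i a}) ∈ U := by
    filter_upwards [h] with a ha
    simpa using ha
  exact (Ultrafilter.finite_biUnion_mem_iff ht).1 this

/-- Fix `N ∈ M`. A union of `n` pieces containing `N` has `n ≤ N`, so each initial part of `M`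
splits into at most `N` pieces, padded by empty sets. The limits of the pieces along an ultrafilter
cover `M`; finite subsets of a nonempty limit lie in `S` by heredity, so each limit is finite. -/
theorem IsCompactFamily.schreierSucc {S : Set (Finset ℕ+)} (hS : IsHereditary S)
    (hc : IsCompactFamily S) : IsCompactFamily (schreierSucc S) := by
  classical
  intro M hM
  rcases M.eq_empty_or_nonempty with rfl | ⟨N, hN⟩
  · exact Set.finite_empty
  set J : ℕ+ → Finset ℕ+ := fun j => (Finset.Iic (max j N)).filter (· ∈ M) with hJ
  have hcover : ∀ j, ∃ A : ℕ → Finset ℕ+, (∀ i, A i ∈ S ∨ A i = ∅) ∧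
      ∀ a ∈ J j, ∃ i ∈ Set.Iio (N : ℕ), a ∈ A i := by
    intro j
    have hNJ : N ∈ J j := by simp [hJ, hN]
    rcases hM (J j) (by intro a ha; exact (Finset.mem_filter.1 ha).2) with h | ⟨n, G, hG, -, hn, h⟩
    · simp [h] at hNJ
    · refine ⟨fun i => if hi : i < n then G ⟨i, hi⟩ else ∅, fun i => ?_, fun a ha => ?_⟩
      · dsimp only
        split_ifs with hi
        · exact Or.inl (hG _).1
        · exact Or.inr rfl
      · rw [h, Finset.mem_biUnion] at ha hNJ
        obtain ⟨i₀, -, hi₀⟩ := hNJ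
        obtain ⟨i, -, hi⟩ := ha
        exact ⟨i, i.2.trans_le (hn _ _ hi₀), by simpa using hi⟩
  choose A hA hAJ using hcover
  let U : Ultrafilter ℕ+ := Ultrafilter.of atTop
  have hU : (U : Filter ℕ+) ≤ atTop := Ultrafilter.of_le atTop
  have hMU : M ⊆ ⋃ i ∈ Set.Iio (N : ℕ), {a | ∀ᶠ j in (U : Filter ℕ+), a ∈ A j i} := by
    intro a ha
    have := exists_eventually_of_finite U (Set.finite_Iio (N : ℕ)) (p := fun i j => a ∈ A j i)
      (hU ((eventually_ge_atTop a).mono fun j hj => hAJ j a (by simp [hJ, ha, hj])))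
    simpa using this
  refine (Set.Finite.biUnion (Set.finite_Iio _) fun i _ => ?_).subset hMU
  by_cases hne : {a | ∀ᶠ j in (U : Filter ℕ+), a ∈ A j i} = ∅
  · rw [hne]; exact Set.finite_empty
  obtain ⟨b, hb⟩ := Set.nonempty_iff_ne_empty.2 hne
  refine hc _ fun E hE => ?_
  have : ∀ᶠ j in (U : Filter ℕ+), ∀ a ∈ E, a ∈ A j i :=
    (Finset.eventually_all E).2 fun a ha => hE ha
  obtain ⟨j, hj, hbj⟩ := (this.and hb).exists
  rcases hA j i with h | h
  · exact hS _ h _ hj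
  · simp [h] at hbj

section Limit

variable (F : ℕ+ → Set (Finset ℕ+))

theorem IsHereditary.limit (h : ∀ n, IsHereditary (F n)) :
    IsHereditary {E | ∃ n : ℕ+, (∀ a ∈ E, n ≤ a) ∧ E ∈ F n} := by
  rintro E ⟨n, hn, hE⟩ G hG
  exact ⟨n, fun a ha => hn a (hG ha), h n E hE G hG⟩

theorem IsSpreading.limit (h : ∀ n, IsSpreading (F n)) :
    IsSpreading {E | ∃ n : ℕ+, (∀ a ∈ E, n ≤ a) ∧ E ∈ F n} := by
  rintro k hk E ⟨n, hn, hE⟩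
  refine ⟨n, fun a ha => ?_, h n k hk E hE⟩
  obtain ⟨a, ha', rfl⟩ := Finset.mem_image.1 ha
  exact (hn a ha').trans (PNat.le_apply_of_strictMono hk a)

/-- A set containing `N` can only use a level `n ≤ N`, so an ultrafilter fixes one level for the
initial parts of `M`, and compactness at that level applies. -/
theorem IsCompactFamily.limit (hF : ∀ n, IsHereditary (F n)) (h : ∀ n, IsCompactFamily (F n)) :
    IsCompactFamily {E | ∃ n : ℕ+, (∀ a ∈ E, n ≤ a) ∧ E ∈ F n} := by
  classical
  intro M hM
  rcases M.eq_empty_or_nonempty with rfl | ⟨N, hN⟩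
  · exact Set.finite_empty
  set J : ℕ+ → Finset ℕ+ := fun j => (Finset.Iic (max j N)).filter (· ∈ M) with hJ
  let U : Ultrafilter ℕ+ := Ultrafilter.of atTop
  have hU : (U : Filter ℕ+) ≤ atTop := Ultrafilter.of_le atTop
  obtain ⟨n, -, hn⟩ := exists_eventually_of_finite U (Set.finite_Iic N)
    (p := fun n j => J j ∈ F n) (Eventually.of_forall fun j => by
      obtain ⟨n, hn, hE⟩ := hM (J j) (fun a ha => (Finset.mem_filter.1 ha).2)
      exact ⟨n, hn N (by simp [hJ, hN]), hE⟩)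
  refine h n M fun E hE => ?_
  have : ∀ᶠ j in (U : Filter ℕ+), ∀ a ∈ E, a ∈ J j :=
    (Finset.eventually_all E).2 fun a ha =>
      hU ((eventually_ge_atTop a).mono fun j hj => by simp [hJ, hE ha, hj])
  obtain ⟨j, hj, hjn⟩ := (this.and hn).exists
  exact hF n _ hjn _ hj

end Limit

theorem schreier_regular {c : Ordinal.{0} → ℕ+ → Ordinal.{0}} (hc : IsFundamentalChoice c)
    (ξ : Ordinal.{0}) (hξ : ξ < ω₁) :
    IsHereditary (schreier c ξ) ∧ IsSpreading (schreier c ξ) ∧ IsCompactFamily (schreier c ξ) := by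
  induction ξ using Ordinal.limitRecOn with
  | zero =>
    rw [schreier_zero]
    exact ⟨isHereditary_schreierZero, isSpreading_schreierZero, isCompactFamily_schreierZero⟩
  | add_one ξ ih =>
    obtain ⟨h1, h2, h3⟩ := ih ((lt_add_one ξ).trans hξ)
    rw [schreier_add_one]
    exact ⟨h1.schreierSucc, h2.schreierSucc, h3.schreierSucc h1⟩
  | limit ξ hlim ih =>
    obtain ⟨hm, hl⟩ := hc ξ hlim hξ
    have hlt : ∀ n, c ξ n < ξ := fun n =>
      (hm (PNat.lt_add_right n 1)).trans_le (hl.1 ⟨n + 1, rfl⟩)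
    have H := fun n => ih (c ξ n) (hlt n) ((hlt n).trans hξ)
    rw [schreier_limit hc hlim hξ]
    exact ⟨IsHereditary.limit _ fun n => (H n).1, IsSpreading.limit _ fun n => (H n).2.1,
      IsCompactFamily.limit _ (fun n => (H n).1) fun n => (H n).2.2⟩

/-- This permits recursion from large members of `S` down to their subsets: the union of an infinite
increasing chain in `S` would be an infinite set with all finite subsets in `S`. -/
theorem IsCompactFamily.wellFounded {S : Set (Finset ℕ+)} (hS : IsHereditary S)
    (hc : IsCompactFamily S) : WellFounded fun a b : Finset ℕ+ => b ⊂ a ∧ a ∈ S := by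
  rw [wellFounded_iff_isEmpty_descending_chain]
  refine ⟨fun ⟨f, hf⟩ => ?_⟩
  have hmono : StrictMono f := strictMono_nat_of_lt_succ fun n => (hf n).1
  have hfin : (⋃ n, (f n : Set ℕ+)).Finite := by
    refine hc _ fun E hE => ?_
    have hd : Directed (· ⊆ ·) fun n => (f n : Set ℕ+) :=
      Monotone.directed_le fun a b hab => Finset.coe_subset.2 (hmono.monotone hab)
    obtain ⟨n, hn⟩ := hd.exists_mem_subset_of_finset_subset_biUnion hE
    exact hS _ (hf n).2 _ ((Finset.coe_subset.1 hn).trans (hf n).1.1)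
  have hb : ∀ n, f n ⊆ hfin.toFinset := fun n a ha => by
    simp only [Set.Finite.mem_toFinset, Set.mem_iUnion]
    exact ⟨n, ha⟩
  have hcard : StrictMono fun n => (f n).card := fun a b hab => Finset.card_lt_card (hmono hab)
  have := (hcard.id_le (hfin.toFinset.card + 1)).trans (Finset.card_le_card (hb _))
  simp at this

/-! ### Weak limits, Mazur, Banach–Alaoglu and norming sets. -/

section Functionals

variable {𝕜 : Type*} [RCLike 𝕜] {X : Type*} [NormedAddCommGroup X] [NormedSpace 𝕜 X]

theorem continuous_apply_weakSpace (f : StrongDual 𝕜 X) :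
    Continuous fun w : WeakSpace 𝕜 X => f ((toWeakSpace 𝕜 X).symm w) :=
  WeakBilin.eval_continuous (topDualPairing 𝕜 X).flip f

theorem toWeakSpace_tendsto_iff {α : Type*} {l : Filter α} {x : α → X} {y : X} :
    Tendsto (fun n => toWeakSpace 𝕜 X (x n)) l (𝓝 (toWeakSpace 𝕜 X y)) ↔
      ∀ f : StrongDual 𝕜 X, Tendsto (fun n => f (x n)) l (𝓝 (f y)) := by
  refine WeakBilin.tendsto_iff_forall_eval_tendsto (topDualPairing 𝕜 X).flip fun a b hab => ?_
  exact (SeparatingDual.eq_iff_forall_dual_eq (R := 𝕜)).2 fun f => congrArg (fun g => g f) hab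

theorem weaklyConvergesTo_iff {x : ℕ+ → X} {y : X} :
    WeaklyConvergesTo 𝕜 x y ↔
      ∀ f : StrongDual 𝕜 X, Tendsto (fun n => f (x n)) atTop (𝓝 (f y)) :=
  toWeakSpace_tendsto_iff

theorem subset_weakClosure (K : Set X) : K ⊆ weakClosure 𝕜 K :=
  Set.image_subset_iff.1 subset_closure

theorem exists_mem_forall_norm_sub_lt {K : Set X} {y : X} (hy : y ∈ weakClosure 𝕜 K)
    (T : Finset (StrongDual 𝕜 X)) {ε : ℝ} (hε : 0 < ε) :
    ∃ w ∈ K, ∀ f ∈ T, ‖f w - f y‖ < ε := by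
  have hy' : toWeakSpace 𝕜 X y ∈ closure (toWeakSpace 𝕜 X '' K) := hy
  have h : ∀ᶠ w in 𝓝 (toWeakSpace 𝕜 X y), ∀ f ∈ T,
      ‖f ((toWeakSpace 𝕜 X).symm w) - f y‖ < ε := by
    refine (Finset.eventually_all T).2 fun f _ => ?_
    have := (((continuous_apply_weakSpace f).tendsto (toWeakSpace 𝕜 X y)).sub_const (f y)).norm
    simp only [LinearEquiv.symm_apply_apply, sub_self, norm_zero] at this
    exact this.eventually_lt_const hε
  obtain ⟨_, hw, ⟨w, hwK, rfl⟩⟩ := mem_closure_iff_nhds.1 hy' _ h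
  exact ⟨w, hwK, hw⟩

theorem mem_weakClosure_of_weaklyConvergesTo {K : Set X} {x : ℕ+ → X} {y : X}
    (hx : ∀ n, x n ∈ weakClosure 𝕜 K) (h : WeaklyConvergesTo 𝕜 x y) : y ∈ weakClosure 𝕜 K := by
  have : toWeakSpace 𝕜 X y ∈ closure (toWeakSpace 𝕜 X '' K) :=
    isClosed_closure.mem_of_tendsto h (Eventually.of_forall hx)
  exact this

/-- Mazur's theorem: convex sets have the same weak and norm closures. Convexity is over `ℝ`, hence
the restriction of scalars. -/
theorem mem_topologicalClosure_of_tendsto {α : Type*} {l : Filter α} [l.NeBot] {x : α → X}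
    {y : X} {V : Submodule 𝕜 X} (hx : ∀ n, x n ∈ V)
    (h : ∀ f : StrongDual 𝕜 X, Tendsto (fun n => f (x n)) l (𝓝 (f y))) :
    y ∈ closure (V : Set X) := by
  let _ : NormedSpace ℝ X := NormedSpace.restrictScalars ℝ 𝕜 X
  have : IsScalarTower ℝ 𝕜 X := RestrictScalars.isScalarTower ℝ 𝕜 X
  have hc : Convex ℝ (V : Set X) := (V.restrictScalars ℝ).convex
  have : toWeakSpace 𝕜 X y ∈ closure (toWeakSpace 𝕜 X '' (V : Set X)) :=
    mem_closure_of_tendsto (toWeakSpace_tendsto_iff.2 h)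
      (Eventually.of_forall fun n => ⟨x n, hx n, rfl⟩)
  rw [← hc.toWeakSpace_closure 𝕜] at this
  obtain ⟨z, hz, hzy⟩ := this
  rwa [← (toWeakSpace 𝕜 X).injective hzy]

/-- Banach–Alaoglu along an ultrafilter. -/
theorem exists_dual_tendsto_ultrafilter {α : Type*} (U : Ultrafilter α) {C : ℝ}
    {g : α → StrongDual 𝕜 X} (hg : ∀ᶠ a in (U : Filter α), ‖g a‖ ≤ C) :
    ∃ h : StrongDual 𝕜 X, ‖h‖ ≤ C ∧
      ∀ y, Tendsto (fun a => g a y) (U : Filter α) (𝓝 (h y)) := by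
  obtain ⟨h, hC, hh⟩ := (WeakDual.isCompact_closedBall (𝕜 := 𝕜) (0 : StrongDual 𝕜 X) C)
    |>.ultrafilter_le_nhds' (U.map fun a => StrongDual.toWeakDual (g a)) (by
      refine mem_map.2 (hg.mono fun a ha => ?_)
      simpa using ha)
  refine ⟨WeakDual.toStrongDual h, by simpa using hC, fun y => ?_⟩
  exact ((WeakDual.eval_continuous y).tendsto h).comp (tendsto_map'_iff.1 (tendsto_id.mono_left hh))

/-- A finite-dimensional space of functionals is normed up to a factor `2` by finitely many
vectors of the unit ball. -/
theorem exists_finset_norming (G : Submodule 𝕜 (StrongDual 𝕜 X)) [FiniteDimensional 𝕜 G] :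
    ∃ T : Finset X, (∀ f ∈ T, ‖f‖ ≤ 1) ∧ ∀ η ∈ G, ‖η‖ ≠ 0 → ∃ f ∈ T, ‖η‖ ≤ 2 * ‖η f‖ := by
  have : ProperSpace G := FiniteDimensional.proper_rclike 𝕜 G
  have hpt : ∀ η : StrongDual 𝕜 X, ‖η‖ = 1 → ∃ f : X, ‖f‖ ≤ 1 ∧ 1 / 2 < ‖η f‖ := by
    intro η hη
    by_contra! hcon
    have : ‖η‖ ≤ 1 / 2 := by
      refine le_of_not_gt fun hlt => ?_
      obtain ⟨x, hx, h⟩ := η.exists_lt_apply_of_lt_opNorm hlt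
      exact absurd h (not_lt.2 (hcon x hx.le))
    linarith
  have hs : ∀ ζ : G, ζ ∈ Metric.sphere (0 : G) 1 ↔ ‖ζ.1‖ = 1 := fun ζ => by
    change dist ζ.1 (0 : StrongDual 𝕜 X) = 1 ↔ _
    rw [dist_zero_right]
  have hc : IsCompact (Metric.sphere (0 : G) 1) := isCompact_sphere 0 1
  choose! v hv1 hv2 using hpt
  obtain ⟨t, hcov⟩ := hc.elim_nhds_subcover' (fun η _ => {ζ : G | 1 / 2 < ‖ζ.1 (v η.1)‖})
    (fun η hη => by
      refine IsOpen.mem_nhds (isOpen_lt continuous_const ?_) (hv2 _ ((hs η).1 hη))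
      fun_prop)
  classical
  refine ⟨t.image fun η => v η.1.1, ?_, fun η hη h0 => ?_⟩
  · intro f hf
    obtain ⟨η, -, rfl⟩ := Finset.mem_image.1 hf
    exact hv1 _ ((hs _).1 η.2)
  · set ζ : G := ((‖η‖ : 𝕜)⁻¹) • ⟨η, hη⟩ with hζ
    have hζ1 : ζ ∈ Metric.sphere (0 : G) 1 := by
      rw [hs, hζ, Submodule.coe_smul, norm_smul, norm_inv, RCLike.norm_ofReal, abs_norm]
      exact inv_mul_cancel₀ h0
    obtain ⟨θ, hθ, hlt⟩ := Set.mem_iUnion₂.1 (hcov hζ1)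
    refine ⟨v θ.1.1, Finset.mem_image_of_mem _ hθ, ?_⟩
    have hlt' : 1 / 2 < ‖η‖⁻¹ * ‖η (v θ.1.1)‖ := by
      have : 1 / 2 < ‖ζ.1 (v θ.1.1)‖ := hlt
      rwa [hζ, Submodule.coe_smul, smul_apply, norm_smul, norm_inv,
        RCLike.norm_ofReal, abs_norm] at this
    have hpos : 0 < ‖η‖ := lt_of_le_of_ne (norm_nonneg _) (Ne.symm h0)
    rw [inv_mul_eq_div, lt_div_iff₀ hpos] at hlt'
    linarith

end Functionals

/-! ### The Eberlein–Šmulian theorem. -/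

section EberleinSmulian

variable {𝕜 : Type*} [RCLike 𝕜] {X : Type*} [NormedAddCommGroup X] [NormedSpace 𝕜 X]

variable (𝕜) in
/-- Every sequence in `K` has a weak cluster point in `X`. -/
def IsRelativelyWeaklyCountablyCompact (K : Set X) : Prop :=
  ∀ x : ℕ → X, (∀ n, x n ∈ K) → ∃ l : Filter ℕ, l.NeBot ∧ l ≤ atTop ∧
    ∃ z : X, ∀ f : StrongDual 𝕜 X, Tendsto (fun n => f (x n)) l (𝓝 (f z))

/-- Uniform boundedness in the bidual: if `f` were unbounded on `K`, points with `‖f (x n)‖ > n`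
would have no weak cluster point. -/
theorem IsRelativelyWeaklyCountablyCompact.exists_norm_le {K : Set X}
    (hK : IsRelativelyWeaklyCountablyCompact 𝕜 K) : ∃ R : ℝ, ∀ x ∈ K, ‖x‖ ≤ R := by
  have hpt : ∀ f : StrongDual 𝕜 X, ∃ C : ℝ, ∀ x : K,
      ‖NormedSpace.inclusionInDoubleDual 𝕜 X x.1 f‖ ≤ C := by
    intro f
    by_contra! hcon
    choose x hx using fun n : ℕ => hcon n
    obtain ⟨l, hl, hlt, z, hz⟩ := hK (fun n => (x n).1) fun n => (x n).2
    have h1 : ∀ᶠ n in l, ‖f (x n).1‖ < ‖f z‖ + 1 :=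
      (hz f).norm.eventually_lt_const (lt_add_one _)
    have h2 : ∀ᶠ n : ℕ in l, ‖f z‖ + 1 ≤ n :=
      hlt (tendsto_natCast_atTop_atTop.eventually_ge_atTop (‖f z‖ + 1))
    obtain ⟨n, h1, h2⟩ := (h1.and h2).exists
    have h3 : (n : ℝ) < ‖f (x n).1‖ := hx n
    linarith
  obtain ⟨R, hR⟩ := banach_steinhaus hpt
  refine ⟨R, fun x hx => ?_⟩
  have := hR ⟨x, hx⟩
  rwa [show ‖NormedSpace.inclusionInDoubleDual 𝕜 X x‖ = ‖x‖ from
    (NormedSpace.inclusionInDoubleDualLi 𝕜).norm_map x] at this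

theorem norm_le_of_mem_weakClosure {K : Set X} {R : ℝ} (hR : ∀ x ∈ K, ‖x‖ ≤ R) {x : X}
    (hx : x ∈ weakClosure 𝕜 K) : ‖x‖ ≤ R := by
  obtain ⟨g, hg, hgx⟩ := exists_dual_vector'' 𝕜 x
  refine le_of_forall_pos_le_add fun ε hε => ?_
  obtain ⟨w, hw, hwg⟩ := exists_mem_forall_norm_sub_lt hx {g} hε
  have h1 := hwg g (Finset.mem_singleton_self g)
  have h2 : ‖g x‖ = ‖x‖ := by rw [hgx, RCLike.norm_ofReal, abs_norm]
  have h3 : ‖g w‖ ≤ R := (g.le_of_opNorm_le hg w).trans (by simpa using hR w hw)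
  have h4 := norm_sub_norm_le (g x) (g w)
  rw [norm_sub_rev] at h4
  linarith

/-- The weak-star closure in the bidual of a relatively weakly countably compact set consists of
elements of the space (Whitley's argument). -/
theorem IsRelativelyWeaklyCountablyCompact.exists_eq_inclusion {K : Set X}
    (hK : IsRelativelyWeaklyCountablyCompact 𝕜 K) (φ : StrongDual 𝕜 (StrongDual 𝕜 X))
    (hφ : ∀ (T : Finset (StrongDual 𝕜 X)) (ε : ℝ), 0 < ε → ∃ w ∈ K, ∀ f ∈ T, ‖f w - φ f‖ < ε) :
    ∃ z : X, NormedSpace.inclusionInDoubleDual 𝕜 X z = φ := by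
  classical
  set J := NormedSpace.inclusionInDoubleDual 𝕜 X with hJ
  have hJnorm : ∀ x, ‖J x‖ = ‖x‖ := (NormedSpace.inclusionInDoubleDualLi 𝕜).norm_map
  choose N hN1 hN using fun H : Finset X => exists_finset_norming
    (Submodule.span 𝕜 {φ} ⊔ (Submodule.span 𝕜 (H : Set X)).map J.toLinearMap)
  choose p hpK hp using fun (T : Finset (StrongDual 𝕜 X)) (n : ℕ) =>
    hφ T (1 / ((n : ℝ) + 1)) Nat.one_div_pos_of_nat
  -- A state holds the vectors chosen and the functionals collected so far. Functionals norming the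
  -- span of `φ` and the earlier vectors are added before `w n` is chosen to agree with `φ` on all
  -- of them up to `1/(n+1)`.
  let st : ℕ → Finset X × Finset (StrongDual 𝕜 X) := fun n =>
    Nat.rec (∅, ∅) (fun n s => (insert (p (s.2 ∪ N s.1) n) s.1, s.2 ∪ N s.1)) n
  set w : ℕ → X := fun n => p (st (n + 1)).2 n with hw
  have hst1 : ∀ n, (st (n + 1)).1 = insert (w n) (st n).1 := fun n => rfl
  have hst2 : ∀ n, (st (n + 1)).2 = (st n).2 ∪ N (st n).1 := fun n => rfl
  have hH : Monotone fun n => (st n).1 :=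
    monotone_nat_of_le_succ fun n => by rw [hst1]; exact Finset.subset_insert _ _
  have hA : Monotone fun n => (st n).2 :=
    monotone_nat_of_le_succ fun n => by rw [hst2]; exact Finset.subset_union_left
  obtain ⟨l, hl, hlt, z, hz⟩ := hK w fun n => hpK _ n
  have hφz : ∀ m, ∀ f ∈ (st m).2, φ f = f z := by
    intro m f hf
    refine tendsto_nhds_unique (f := fun n => f (w n)) (l := l) ?_ (hz f)
    rw [tendsto_iff_norm_sub_tendsto_zero]
    refine squeeze_zero' (Eventually.of_forall fun n => norm_nonneg _) ?_
      (tendsto_one_div_add_atTop_nhds_zero_nat.mono_left hlt)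
    filter_upwards [hlt (eventually_ge_atTop m)] with n hn
    exact (hp _ n f (hA (hn.trans n.le_succ) hf)).le
  have hzcl : z ∈ closure (Submodule.span 𝕜 (Set.range w) : Set X) :=
    mem_topologicalClosure_of_tendsto (fun n => Submodule.subset_span ⟨n, rfl⟩) hz
  have hspan : ∀ y ∈ Submodule.span 𝕜 (Set.range w),
      ∃ n, y ∈ Submodule.span 𝕜 ((st n).1 : Set X) := by
    intro y hy
    have hdir : Directed (· ≤ ·) fun n => Submodule.span 𝕜 ((st n).1 : Set X) :=
      Monotone.directed_le fun a b hab => Submodule.span_mono (Finset.coe_subset.2 (hH hab))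
    refine (Submodule.mem_iSup_of_directed _ hdir).1 (Submodule.span_le.2 ?_ hy)
    rintro _ ⟨n, rfl⟩
    refine Submodule.mem_iSup_of_mem (n + 1) (Submodule.subset_span ?_)
    rw [hst1]
    simp
  refine ⟨z, ?_⟩
  refine sub_eq_zero.1 (norm_le_zero_iff.1 (le_of_forall_pos_le_add fun ε hε => ?_))
  obtain ⟨y, hy, hyz⟩ := Metric.mem_closure_iff.1 hzcl (ε / 3) (by positivity)
  obtain ⟨n, hn⟩ := hspan y hy
  -- On collected functionals `φ` agrees with `z`, so the norming ones see `φ - J y` as `z - y`; the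
  -- norming factor `2` gives `2 * (ε / 3)`.
  have hη : ‖φ - J y‖ ≤ 2 * (ε / 3) := by
    by_cases h0 : ‖φ - J y‖ = 0
    · rw [h0]; positivity
    obtain ⟨f, hf, hle⟩ := hN (st n).1 (φ - J y) (Submodule.sub_mem _
      (Submodule.mem_sup_left (Submodule.mem_span_singleton_self φ))
      (Submodule.mem_sup_right ⟨y, hn, rfl⟩)) h0
    have hf' : φ f = f z := hφz (n + 1) f (by rw [hst2]; exact Finset.mem_union_right _ hf)
    have : ‖(φ - J y) f‖ ≤ ‖z - y‖ := by
      rw [sub_apply, hf', hJ, NormedSpace.dual_def, ← map_sub]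
      simpa using f.le_of_opNorm_le (hN1 _ f hf) (z - y)
    rw [dist_eq_norm] at hyz
    linarith
  have h2 : ‖J (z - y)‖ < ε / 3 := by rw [hJnorm, ← dist_eq_norm]; exact hyz
  have h3 : J z - φ = J (z - y) - (φ - J y) := by rw [map_sub]; abel
  rw [h3]
  have := norm_sub_le (J (z - y)) (φ - J y)
  linarith

theorem IsRelativelyWeaklyCountablyCompact.exists_tendsto_ultrafilter {K : Set X}
    (hK : IsRelativelyWeaklyCountablyCompact 𝕜 K) {α : Type*} (U : Ultrafilter α) {x : α → X}
    (hx : ∀ n, x n ∈ weakClosure 𝕜 K) :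
    ∃ z : X, ∀ f : StrongDual 𝕜 X, Tendsto (fun n => f (x n)) (U : Filter α) (𝓝 (f z)) := by
  obtain ⟨R, hR⟩ := hK.exists_norm_le
  obtain ⟨φ, -, hφ⟩ := exists_dual_tendsto_ultrafilter U (C := R)
    (g := fun n => NormedSpace.inclusionInDoubleDual 𝕜 X (x n))
    (Eventually.of_forall fun n => (NormedSpace.double_dual_bound 𝕜 X _).trans
      (norm_le_of_mem_weakClosure hR (hx n)))
  obtain ⟨z, rfl⟩ := hK.exists_eq_inclusion φ fun T ε hε => by
    have : ∀ᶠ n in (U : Filter α), ∀ f ∈ T, ‖f (x n) - φ f‖ < ε / 2 := by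
      refine (Finset.eventually_all T).2 fun f _ => ?_
      exact (tendsto_iff_norm_sub_tendsto_zero.1 (hφ f)).eventually_lt_const (half_pos hε)
    obtain ⟨n, hn⟩ := this.exists
    obtain ⟨w, hw, hwT⟩ := exists_mem_forall_norm_sub_lt (hx n) T (half_pos hε)
    refine ⟨w, hw, fun f hf => ?_⟩
    have := norm_add_le (f w - f (x n)) (f (x n) - φ f)
    rw [sub_add_sub_cancel] at this
    linarith [hn f hf, hwT f hf]
  exact ⟨z, hφ⟩

/-- For `b ∈ c` near `y`, the functional norming `b` kills `y`, so `‖b‖ ≤ ‖y - b‖` is small. Thus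
countably many functionals separate the points of a separable subspace. -/
theorem eq_zero_of_forall_norming {c : Set X} {g : c → StrongDual 𝕜 X}
    (hg : ∀ i, ‖g i‖ ≤ 1) (hgi : ∀ i, g i i.1 = (‖i.1‖ : 𝕜)) {y : X} (hy : y ∈ closure c)
    (h : ∀ i, g i y = 0) : y = 0 := by
  rw [← norm_le_zero_iff]
  refine le_of_forall_pos_le_add fun ε hε => ?_
  obtain ⟨b, hb, hyb⟩ := Metric.mem_closure_iff.1 hy (ε / 2) (half_pos hε)
  rw [dist_eq_norm] at hyb
  have h1 : ‖b‖ ≤ ‖y - b‖ := by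
    have h2 : ‖g ⟨b, hb⟩ (y - b)‖ = ‖b‖ := by
      rw [map_sub, h, hgi, zero_sub, norm_neg, RCLike.norm_ofReal, abs_norm]
    rw [← h2]
    simpa using (g ⟨b, hb⟩).le_of_opNorm_le (hg _) (y - b)
  have := norm_add_le (y - b) b
  rw [sub_add_cancel] at this
  linarith

/-- Eberlein–Šmulian: sequences in the weak closure of a relatively weakly countably compact set
have weakly convergent subsequences. -/
theorem IsRelativelyWeaklyCountablyCompact.exists_subseq {K : Set X}
    (hK : IsRelativelyWeaklyCountablyCompact 𝕜 K) {x : ℕ+ → X}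
    (hx : ∀ n, x n ∈ weakClosure 𝕜 K) :
    ∃ k : ℕ+ → ℕ+, StrictMono k ∧ ∃ y, WeaklyConvergesTo 𝕜 (fun n => x (k n)) y := by
  obtain ⟨R, hR⟩ := hK.exists_norm_le
  have hxR := fun n => norm_le_of_mem_weakClosure hR (hx n)
  obtain ⟨c, hc, hspan⟩ : TopologicalSpace.IsSeparable
      (Submodule.span 𝕜 (Set.range x) : Set X) :=
    (Set.countable_range x).isSeparable.span
  have hcl : closure (Submodule.span 𝕜 (Set.range x) : Set X) ⊆ closure c :=
    closure_minimal hspan isClosed_closure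
  have := hc.to_subtype
  choose g hg hgi using fun i : c => exists_dual_vector'' 𝕜 i.1
  -- Sequential compactness of a countable product of balls replaces the diagonal argument: every `g
  -- i` converges along one subsequence.
  have hcomp : IsCompact (Set.univ.pi fun _ : c => Metric.closedBall (0 : 𝕜) R) :=
    isCompact_univ_pi fun _ => isCompact_closedBall 0 R
  obtain ⟨a, -, ψ, hψ, ha⟩ := hcomp.tendsto_subseq
    (x := fun (n : ℕ) (i : c) => g i (x n.succPNat)) (fun n i _ => by
      rw [mem_closedBall_zero_iff]
      exact ((g i).le_of_opNorm_le (hg i) _).trans (by simpa using hxR _))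
  set k : ℕ+ → ℕ+ := fun n => (ψ n.natPred).succPNat with hk
  have hkm : StrictMono k := fun m n h =>
    Nat.succPNat_strictMono (hψ (PNat.natPred_strictMono h))
  have hka : ∀ i, Tendsto (fun n => g i (x (k n))) atTop (𝓝 (a i)) := fun i =>
    ((tendsto_pi_nhds.1 ha) i).comp
      OrderIso.pnatIsoNat.tendsto_atTop
  have hlim := fun U : Ultrafilter ℕ+ =>
    hK.exists_tendsto_ultrafilter U (x := fun n => x (k n)) fun n => hx _
  have hmem : ∀ (U : Ultrafilter ℕ+) (z : X), (∀ f : StrongDual 𝕜 X,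
      Tendsto (fun n => f (x (k n))) (U : Filter ℕ+) (𝓝 (f z))) →
      z ∈ (Submodule.span 𝕜 (Set.range x)).topologicalClosure := fun U z hz =>
    mem_topologicalClosure_of_tendsto (fun n => Submodule.subset_span ⟨k n, rfl⟩) hz
  obtain ⟨z, hz⟩ := hlim (Ultrafilter.of atTop)
  refine ⟨k, hkm, z, weaklyConvergesTo_iff.2 fun f => ?_⟩
  -- Each ultrafilter has a weak limit; any two lie in the closed span of `x` and agree under every
  -- `g i`, hence coincide.
  rw [tendsto_iff_ultrafilter]
  intro U hU
  obtain ⟨z', hz'⟩ := hlim U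
  suffices h : z' - z = 0 by
    rw [← sub_eq_zero.1 h]
    exact hz' f
  refine eq_zero_of_forall_norming hg hgi
    (hcl (Submodule.sub_mem _ (hmem _ _ hz') (hmem _ _ hz))) fun i => ?_
  rw [map_sub, sub_eq_zero, tendsto_nhds_unique (hz' (g i)) ((hka i).mono_left hU),
    tendsto_nhds_unique (hz (g i)) ((hka i).mono_left (Ultrafilter.of_le atTop))]

theorem isRelativelyWeaklyCountablyCompact_of_subseq {K : Set X}
    (hK : ∀ x : ℕ+ → X, (∀ n, x n ∈ K) → ∃ k : ℕ+ → ℕ+, StrictMono k ∧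
      ∃ y, WeaklyConvergesTo 𝕜 (fun n => x (k n)) y) :
    IsRelativelyWeaklyCountablyCompact 𝕜 K := by
  intro x hx
  obtain ⟨k, hk, y, hy⟩ := hK (fun n => x n.natPred) fun n => hx _
  refine ⟨map (fun n => (k n).natPred) atTop, inferInstance, ?_, y, fun f => ?_⟩
  · exact OrderIso.pnatIsoNat.tendsto_atTop.comp (PNat.tendsto_atTop_of_strictMono hk)
  · exact tendsto_map'_iff.2 (weaklyConvergesTo_iff.1 hy f)

end EberleinSmulian

/-! ### Transfer of spreading models from the weak closure to `K`. -/

section SpreadingModels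

variable {𝕜 : Type*} [RCLike 𝕜] {X : Type*} [NormedAddCommGroup X] [NormedSpace 𝕜 X]

/-- A lower `ℓ₁`-estimate on finitely many vectors yields a bounded functional equal to `1` on
each of them. -/
theorem exists_dual_eq_one {δ : ℝ} (hδ : 0 < δ) {u : ℕ+ → X} {E : Finset ℕ+}
    (h : ∀ a : ℕ+ → 𝕜, ∑ n ∈ E, ‖a n‖ = 1 → δ ≤ ‖∑ n ∈ E, a n • u n‖) :
    ∃ g : StrongDual 𝕜 X, ‖g‖ ≤ 1 / δ ∧ ∀ n ∈ E, g (u n) = 1 := by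
  classical
  have h1 : ∀ a : ℕ+ → 𝕜, δ * ∑ n ∈ E, ‖a n‖ ≤ ‖∑ n ∈ E, a n • u n‖ := by
    intro a
    set r := ∑ n ∈ E, ‖a n‖ with hr
    have hr0 : 0 ≤ r := Finset.sum_nonneg fun _ _ => norm_nonneg _
    rcases hr0.eq_or_lt with h0 | h0
    · rw [← h0, mul_zero]; exact norm_nonneg _
    have hn : ‖((r : 𝕜)⁻¹)‖ = r⁻¹ := by rw [norm_inv, RCLike.norm_ofReal, abs_of_pos h0]
    have := h (fun n => (r : 𝕜)⁻¹ * a n) (by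
      simp only [norm_mul, hn, ← Finset.mul_sum, ← hr]
      exact inv_mul_cancel₀ h0.ne')
    simp only [mul_smul, ← Finset.smul_sum, norm_smul, hn] at this
    rw [inv_mul_eq_div, le_div_iff₀ h0] at this
    exact this
  let L : (E → 𝕜) →ₗ[𝕜] X := Fintype.linearCombination 𝕜 fun i : E => u i
  have hL : ∀ b : E → 𝕜, δ * ∑ i, ‖b i‖ ≤ ‖L b‖ := by
    intro b
    have := h1 fun n => if hn : n ∈ E then b ⟨n, hn⟩ else 0
    rw [← Finset.sum_coe_sort E, ← Finset.sum_coe_sort E] at this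
    simpa [L, Fintype.linearCombination_apply] using this
  have hinj : Function.Injective L := by
    rw [← LinearMap.ker_eq_bot, LinearMap.ker_eq_bot']
    intro b hb
    have h2 := hL b
    rw [hb, norm_zero] at h2
    have h3 : ∑ i, ‖b i‖ ≤ 0 := by
      by_contra! hcon
      exact absurd h2 (not_le.2 (mul_pos hδ hcon))
    funext i
    exact norm_le_zero_iff.1
      ((Finset.single_le_sum (fun j _ => norm_nonneg (b j)) (Finset.mem_univ i)).trans h3)
  let e := LinearEquiv.ofInjective L hinj
  -- The sum of the coefficients is `1` on each `u n`, and by `hL` it has norm at most `1/δ` on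
  -- their span; Hahn–Banach extends it.
  let s : (E → 𝕜) →ₗ[𝕜] 𝕜 := Fintype.linearCombination 𝕜 fun _ : E => (1 : 𝕜)
  let f : StrongDual 𝕜 (LinearMap.range L) :=
    (s ∘ₗ e.symm.toLinearMap).mkContinuous (1 / δ) fun y => by
      have hy : L (e.symm y) = y := congrArg Subtype.val (e.apply_symm_apply y)
      have h2 := hL (e.symm y)
      rw [hy] at h2
      rw [one_div, inv_mul_eq_div, le_div_iff₀ hδ, mul_comm]
      refine le_trans (mul_le_mul_of_nonneg_left ?_ hδ.le) h2
      simpa [s, Fintype.linearCombination_apply] using norm_sum_le Finset.univ (e.symm y)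
  obtain ⟨g, hg, hgn⟩ := exists_extension_norm_eq _ f
  refine ⟨g, hgn.trans_le (LinearMap.mkContinuous_norm_le _ (by positivity) _), fun n hn => ?_⟩
  have hLn : L (Pi.single ⟨n, hn⟩ 1) = u n := by
    simp [L, Fintype.linearCombination_apply_single]
  have h3 := hg (e (Pi.single ⟨n, hn⟩ 1))
  have h4 : ((e (Pi.single ⟨n, hn⟩ 1) : LinearMap.range L) : X) = u n := hLn
  rw [h4] at h3
  rw [h3]
  simp [f, s, Fintype.linearCombination_apply_single]

/-- A bounded choice of functionals equal to `1` on the vectors with index in a given member of a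
compact hereditary family can be made continuous along an ultrafilter. -/
theorem exists_coherent_functionals {S : Set (Finset ℕ+)} (hS : IsHereditary S)
    (hc : IsCompactFamily S) {u : ℕ+ → X} {C : ℝ}
    (hg : ∀ E ∈ S, ∃ g : StrongDual 𝕜 X, ‖g‖ ≤ C ∧ ∀ n ∈ E, g (u n) = 1)
    (U : Ultrafilter ℕ+) (hU : (U : Filter ℕ+) ≤ atTop) :
    ∃ f : Finset ℕ+ → StrongDual 𝕜 X, ∀ s ∈ S, ‖f s‖ ≤ C ∧ (∀ n ∈ s, f s (u n) = 1) ∧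
      ((∀ᶠ n in (U : Filter ℕ+), insert n s ∈ S) →
        ∀ y, Tendsto (fun n => f (insert n s) y) (U : Filter ℕ+) (𝓝 (f s y))) := by
  classical
  have wf := hc.wellFounded hS
  let P : (s : Finset ℕ+) → (Finset ℕ+ → StrongDual 𝕜 X) → StrongDual 𝕜 X → Prop :=
    fun s F h => ‖h‖ ≤ C ∧ (∀ n ∈ s, h (u n) = 1) ∧
      ((∀ᶠ n in (U : Filter ℕ+), insert n s ∈ S) →
        ∀ y, Tendsto (fun n => F (insert n s) y) (U : Filter ℕ+) (𝓝 (h y)))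
  -- `f s` is chosen from the values on strictly larger members of `S`; the value `0` elsewhere is
  -- never used, since `insert n s` is strictly larger for almost all `n`.
  let f : Finset ℕ+ → StrongDual 𝕜 X := wf.fix fun s F =>
    Classical.epsilon (P s fun t => if ht : s ⊂ t ∧ t ∈ S then F t ht else 0)
  have hf : ∀ s, f s = Classical.epsilon (P s fun t => if s ⊂ t ∧ t ∈ S then f t else 0) := by
    intro s
    simp only [f]
    rw [wf.fix_eq]
    rfl
  have hev : ∀ s : Finset ℕ+, (∀ᶠ n in (U : Filter ℕ+), insert n s ∈ S) →
      ∀ᶠ n in (U : Filter ℕ+), s ⊂ insert n s ∧ insert n s ∈ S := by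
    intro s hs
    have : ∀ᶠ n in (U : Filter ℕ+), ∀ m ∈ s, m < n :=
      (Finset.eventually_all s).2 fun m _ => hU (eventually_gt_atTop m)
    filter_upwards [hs, this] with n hn hlt
    exact ⟨Finset.ssubset_insert fun h => lt_irrefl _ (hlt n h), hn⟩
  refine ⟨f, fun s => wf.induction (C := fun s => s ∈ S → P s f (f s)) s fun s ih hs => ?_⟩
  have hex : ∃ h, P s (fun t => if s ⊂ t ∧ t ∈ S then f t else 0) h := by
    -- If almost all extensions of `s` stay in `S`, the weak-star limit inherits the bound and the
    -- value `1` on `s`. Otherwise the limit condition is vacuous and any `g` from `hg` serves.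
    by_cases hins : ∀ᶠ n in (U : Filter ℕ+), insert n s ∈ S
    · have hF : ∀ᶠ n in (U : Filter ℕ+), P (insert n s) f
          (if s ⊂ insert n s ∧ insert n s ∈ S then f (insert n s) else 0) := by
        filter_upwards [hev s hins] with n hn
        rw [if_pos hn]
        exact ih _ hn hn.2
      obtain ⟨h, hC, hh⟩ := exists_dual_tendsto_ultrafilter U (hF.mono fun n hn => hn.1)
      refine ⟨h, hC, fun m hm => ?_, fun _ => hh⟩
      refine tendsto_nhds_unique (hh (u m)) (tendsto_const_nhds.congr' ?_)
      filter_upwards [hF] with n hn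
      exact (hn.2.1 m (Finset.mem_insert_of_mem hm)).symm
    · obtain ⟨g, hg1, hg2⟩ := hg s hs
      exact ⟨g, hg1, hg2, fun h => absurd h hins⟩
  have hP := Classical.epsilon_spec hex
  rw [← hf s] at hP
  refine ⟨hP.1, hP.2.1, fun hins y => (hP.2.2 hins y).congr' ?_⟩
  filter_upwards [hev s hins] with n hn
  rw [if_pos hn]

/-- Approximating the terms of a weakly convergent sequence by members of `K`, the coherent
functionals keep biorthogonality along a subsequence. -/
theorem exists_almost_biorthogonal {S : Set (Finset ℕ+)} (hS : IsHereditary S)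
    {U : Ultrafilter ℕ+} (hU : (U : Filter ℕ+) ≤ atTop) {K : Set X} {x : ℕ+ → X} {y : X}
    (hx : ∀ n, x n ∈ weakClosure 𝕜 K) (hxy : WeaklyConvergesTo 𝕜 x y)
    {f : Finset ℕ+ → StrongDual 𝕜 X} (hf1 : ∀ s ∈ S, ∀ n ∈ s, f s (x n - y) = 1)
    (hf : ∀ s ∈ S, (∀ᶠ n in (U : Filter ℕ+), insert n s ∈ S) →
        ∀ v, Tendsto (fun n => f (insert n s) v) (U : Filter ℕ+) (𝓝 (f s v)))
    {ε : ℝ} (hε : 0 < ε) :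
    ∃ (n : ℕ → ℕ+) (w : ℕ → X), StrictMono n ∧ (∀ j, w j ∈ K) ∧
      ∀ E ∈ S, (E : Set ℕ+) ⊆ Set.range n → ∀ j,
        ‖f E (w j - y) - if n j ∈ E then 1 else 0‖ < ε := by
  classical
  let Good : Finset (ℕ+ × X) → Prop := fun H => (∀ p ∈ H, p.2 ∈ K) ∧
    ∀ s ∈ S, s ⊆ H.image Prod.fst → ∀ p ∈ H, ‖f s (p.2 - y) - if p.1 ∈ s then 1 else 0‖ < ε
  have step : ∀ H, Good H → ∃ p, (∀ q ∈ H, q.1 < p.1) ∧ Good (insert p H) := by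
    rintro H ⟨hHK, hH⟩
    set A := H.image Prod.fst with hA
    have e1 : ∀ᶠ n in (U : Filter ℕ+), ∀ q ∈ H, q.1 < n :=
      (Finset.eventually_all H).2 fun q _ => hU (eventually_gt_atTop q.1)
    have e2 : ∀ᶠ n in (U : Filter ℕ+), ∀ s ∈ A.powerset, ‖f s (x n - y)‖ < ε / 2 := by
      refine (Finset.eventually_all _).2 fun s _ => hU ?_
      have := tendsto_iff_norm_sub_tendsto_zero.1 (weaklyConvergesTo_iff.1 hxy (f s))
      simp only [← map_sub] at this
      exact this.eventually_lt_const (half_pos hε)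
    -- The strict bound for `f s` passes to `f (insert n s)` for almost all `n`, so the same `ε`
    -- survives every step. If extensions of `s` are not almost surely in `S`, they are almost
    -- surely outside it and impose nothing.
    have e3 : ∀ᶠ n in (U : Filter ℕ+), ∀ s ∈ A.powerset, s ∈ S → insert n s ∈ S →
        ∀ q ∈ H, ‖f (insert n s) (q.2 - y) - if q.1 ∈ s then 1 else 0‖ < ε := by
      refine (Finset.eventually_all _).2 fun s hs => ?_
      by_cases hsS : s ∈ S
      · by_cases hins : ∀ᶠ n in (U : Filter ℕ+), insert n s ∈ S
        · have : ∀ᶠ n in (U : Filter ℕ+), ∀ q ∈ H,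
              ‖f (insert n s) (q.2 - y) - if q.1 ∈ s then 1 else 0‖ < ε :=
            (Finset.eventually_all H).2 fun q hq =>
              ((hf s hsS hins (q.2 - y)).sub_const _).norm.eventually_lt_const
                (hH s hsS (Finset.mem_powerset.1 hs) q hq)
          exact this.mono fun n hn _ _ => hn
        · exact (Ultrafilter.eventually_not.2 hins).mono fun n hn _ h => absurd h hn
      · exact Eventually.of_forall fun n h => absurd h hsS
    obtain ⟨n, hn1, hn2, hn3⟩ := (e1.and (e2.and e3)).exists
    -- Only the functionals indexed by subsets of `insert n A` matter now, so a weak neighbourhood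
    -- of `x n` suffices.
    obtain ⟨w, hwK, hw⟩ := exists_mem_forall_norm_sub_lt (hx n)
      ((insert n A).powerset.image f) (half_pos hε)
    have hw' : ∀ s ⊆ insert n A, ‖f s (w - y) - f s (x n - y)‖ < ε / 2 := by
      intro s hs
      rw [map_sub, map_sub, sub_sub_sub_cancel_right]
      exact hw _ (Finset.mem_image_of_mem _ (Finset.mem_powerset.2 hs))
    refine ⟨(n, w), hn1, ?_, fun s hsS hs p hp => ?_⟩
    · intro p hp
      rcases Finset.mem_insert.1 hp with rfl | hp
      · exact hwK
      · exact hHK p hp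
    rw [Finset.image_insert] at hs
    by_cases hns : n ∈ s
    · rcases Finset.mem_insert.1 hp with rfl | hp
      · rw [if_pos hns, ← hf1 s hsS n hns]
        exact (hw' s hs).trans (half_lt_self hε)
      · have hne : p.1 ≠ n := (hn1 p hp).ne
        have := hn3 (s.erase n) (Finset.mem_powerset.2 (Finset.subset_insert_iff.1 hs))
          (hS s hsS _ (Finset.erase_subset _ _)) (by rwa [Finset.insert_erase hns]) p hp
        rw [Finset.insert_erase hns] at this
        simpa only [Finset.mem_erase, ne_eq, hne, not_false_eq_true, true_and] using this
    · have hsA : s ⊆ A := (Finset.subset_insert_iff_of_notMem hns).1 hs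
      rcases Finset.mem_insert.1 hp with rfl | hp
      · rw [if_neg hns, sub_zero]
        have h1 := norm_sub_norm_le (f s (w - y)) (f s (x n - y))
        linarith [hw' s hs, hn2 s (Finset.mem_powerset.2 hsA)]
      · exact hH s hsS hsA p hp
  choose! next hnext1 hnext2 using step
  let H : ℕ → Finset (ℕ+ × X) := fun i => Nat.rec ∅ (fun _ G => insert (next G) G) i
  have hHs : ∀ i, H (i + 1) = insert (next (H i)) (H i) := fun i => rfl
  have hGood : ∀ i, Good (H i) := by
    intro i
    induction i with
    | zero => exact ⟨fun p hp => absurd hp (Finset.notMem_empty p),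
        fun s _ _ p hp => absurd hp (Finset.notMem_empty p)⟩
    | succ i ih => exact hnext2 _ ih
  have hmono : Monotone H := monotone_nat_of_le_succ fun i => Finset.subset_insert _ _
  have hmem : ∀ i, next (H i) ∈ H (i + 1) := fun i => Finset.mem_insert_self _ _
  refine ⟨fun i => (next (H i)).1, fun i => (next (H i)).2,
    strictMono_nat_of_lt_succ fun i => hnext1 (H (i + 1)) (hGood (i + 1)) _ (hmem i),
    fun j => (hGood (j + 1)).1 _ (hmem j), fun E hE hEn j => ?_⟩
  have hdir : Directed (· ⊆ ·) fun i => ((H i).image Prod.fst : Set ℕ+) :=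
    Monotone.directed_le fun a b hab =>
      Finset.coe_subset.2 (Finset.image_subset_image (hmono hab))
  obtain ⟨i, hi⟩ := hdir.exists_mem_subset_of_finset_subset_biUnion (s := E) (by
    refine hEn.trans ?_
    rintro _ ⟨i, rfl⟩
    exact Set.mem_iUnion.2 ⟨i + 1, Finset.mem_coe.2 (Finset.mem_image_of_mem _ (hmem i))⟩)
  refine (hGood (max i (j + 1))).2 E hE ?_ _ (hmono (le_max_right _ _) (hmem j))
  exact (Finset.coe_subset.1 hi).trans (Finset.image_subset_image (hmono (le_max_left _ _)))

theorem exists_subset_sum_abs_le {ι : Type*} (E : Finset ι) (b : ι → ℝ) :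
    ∃ F ⊆ E, ∑ i ∈ E, |b i| ≤ 2 * |∑ i ∈ F, b i| := by
  have h := Finset.sum_filter_add_sum_filter_not E (fun i => 0 ≤ b i) fun i => |b i|
  have h1 : ∑ i ∈ E with 0 ≤ b i, |b i| = ∑ i ∈ E with 0 ≤ b i, b i :=
    Finset.sum_congr rfl fun i hi => abs_of_nonneg (Finset.mem_filter.1 hi).2
  have h2 : ∑ i ∈ E with ¬ 0 ≤ b i, |b i| = -∑ i ∈ E with ¬ 0 ≤ b i, b i := by
    rw [← Finset.sum_neg_distrib]
    exact Finset.sum_congr rfl fun i hi => abs_of_neg (not_le.1 (Finset.mem_filter.1 hi).2)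
  rcases le_total (∑ i ∈ E with ¬ 0 ≤ b i, |b i|) (∑ i ∈ E with 0 ≤ b i, |b i|) with hle | hle
  · refine ⟨_, Finset.filter_subset (fun i => 0 ≤ b i) E, ?_⟩
    have := le_abs_self (∑ i ∈ E with 0 ≤ b i, b i)
    linarith
  · refine ⟨_, Finset.filter_subset (fun i => ¬ 0 ≤ b i) E, ?_⟩
    have := neg_le_abs (∑ i ∈ E with ¬ 0 ≤ b i, b i)
    linarith

/-- One factor `2` comes from choosing the real or imaginary part, the other from choosing a sign. A
functional close to the indicator of `F` thus detects a quarter of the `ℓ₁`-norm. -/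
theorem exists_subset_sum_norm_le {ι : Type*} (E : Finset ι) (a : ι → 𝕜) :
    ∃ F ⊆ E, ∑ i ∈ E, ‖a i‖ ≤ 4 * ‖∑ i ∈ F, a i‖ := by
  obtain ⟨F, hF, h1⟩ := exists_subset_sum_abs_le E fun i => RCLike.re (a i)
  obtain ⟨G, hG, h2⟩ := exists_subset_sum_abs_le E fun i => RCLike.im (a i)
  have hri : ∀ z : 𝕜, ‖z‖ ≤ |RCLike.re z| + |RCLike.im z| := fun z => by
    have := norm_add_le (RCLike.re z : 𝕜) (RCLike.im z * RCLike.I)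
    rw [RCLike.re_add_im, norm_mul, RCLike.norm_ofReal, RCLike.norm_ofReal] at this
    exact this.trans (add_le_add_right
      (mul_le_of_le_one_right (abs_nonneg _) (by rw [RCLike.norm_I]; split_ifs <;> norm_num)) _)
  have h3 : ∑ i ∈ E, ‖a i‖ ≤ ∑ i ∈ E, |RCLike.re (a i)| + ∑ i ∈ E, |RCLike.im (a i)| := by
    rw [← Finset.sum_add_distrib]
    exact Finset.sum_le_sum fun i _ => hri (a i)
  have h4 := RCLike.abs_re_le_norm (∑ i ∈ F, a i)
  have h5 := RCLike.abs_im_le_norm (∑ i ∈ G, a i)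
  rw [map_sum] at h4 h5
  rcases le_total ‖∑ i ∈ G, a i‖ ‖∑ i ∈ F, a i‖ with h | h
  · exact ⟨F, hF, by linarith⟩
  · exact ⟨G, hG, by linarith⟩

/-- The functional indexed by `F.image e` sends the combination to within `1/8` of a sum of modulus
at least `1/4`, leaving `1/8`; dividing by `C` gives the constant. -/
theorem IsSpreadingModel.of_almost_biorthogonal {S : Set (Finset ℕ+)} (hS : IsHereditary S)
    (hsp : IsSpreading S) {C : ℝ} (hC : 0 < C) {f : Finset ℕ+ → StrongDual 𝕜 X}
    (hf : ∀ s ∈ S, ‖f s‖ ≤ C) {e : ℕ+ → ℕ+} (he : StrictMono e) {v : ℕ+ → X} {y z : X}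
    (hv : ∀ E ∈ S, (E : Set ℕ+) ⊆ Set.range e → ∀ j,
      ‖f E (v j - y) - if e j ∈ E then 1 else 0‖ < 1 / 16)
    (hz : WeaklyConvergesTo 𝕜 v z) : IsSpreadingModel 𝕜 S fun n => v n - z := by
  classical
  refine ⟨1 / (8 * C), by positivity, fun E hE a ha => ?_⟩
  obtain ⟨F, hF, hsum⟩ := exists_subset_sum_norm_le E a
  rw [ha] at hsum
  have hFS : F.image e ∈ S := hsp e he F (hS E hE F hF)
  set g := f (F.image e) with hg
  have hvj := hv _ hFS (by rw [Finset.coe_image]; exact Set.image_subset_range _ _)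
  have hlim : Tendsto (fun j => g (v j - y)) atTop (𝓝 (g (z - y))) := by
    simp only [map_sub]
    exact (weaklyConvergesTo_iff.1 hz g).sub_const _
  -- The limit `z` may differ from `y`, but `e j` leaves `F.image e` eventually, so `g` hardly sees
  -- the difference.
  have hyz : ‖g (z - y)‖ ≤ 1 / 16 := by
    refine le_of_tendsto hlim.norm ?_
    have : ∀ᶠ j in atTop, ∀ i ∈ F, i < j :=
      (Finset.eventually_all F).2 fun i _ => eventually_gt_atTop i
    filter_upwards [this] with j hj
    have hne : e j ∉ F.image e := fun h => by
      obtain ⟨i, hi, hij⟩ := Finset.mem_image.1 h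
      exact (hj i hi).ne (he.injective hij)
    have := hvj j
    rw [if_neg hne, sub_zero] at this
    exact this.le
  have hterm : ∀ i, ‖g (v i - z) - if i ∈ F then 1 else 0‖ ≤ 1 / 8 := by
    intro i
    have h1 := hvj i
    simp only [he.injective.mem_finset_image] at h1
    have h2 : g (v i - z) - (if i ∈ F then 1 else 0) =
        (g (v i - y) - if i ∈ F then 1 else 0) - g (z - y) := by
      simp only [map_sub]; ring
    rw [h2]
    have := norm_sub_le (g (v i - y) - if i ∈ F then 1 else 0) (g (z - y))
    linarith
  have hdiff : ‖g (∑ i ∈ E, a i • (v i - z)) - ∑ i ∈ F, a i‖ ≤ 1 / 8 := by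
    have h1 : ∑ i ∈ F, a i = ∑ i ∈ E, a i * if i ∈ F then 1 else 0 := by
      simp only [mul_ite, mul_one, mul_zero, ← Finset.sum_filter]
      rw [Finset.filter_mem_eq_inter, Finset.inter_eq_right.2 hF]
    rw [h1, map_sum, ← Finset.sum_sub_distrib]
    refine (norm_sum_le _ _).trans ?_
    calc ∑ i ∈ E, ‖g (a i • (v i - z)) - a i * if i ∈ F then 1 else 0‖
        ≤ ∑ i ∈ E, ‖a i‖ * (1 / 8) := by
          refine Finset.sum_le_sum fun i _ => ?_
          rw [map_smul, smul_eq_mul, ← mul_sub, norm_mul]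
          exact mul_le_mul_of_nonneg_left (hterm i) (norm_nonneg _)
      _ = 1 / 8 := by rw [← Finset.sum_mul, ha, one_mul]
  have h1 := norm_sub_norm_le (∑ i ∈ F, a i) (g (∑ i ∈ E, a i • (v i - z)))
  rw [norm_sub_rev] at h1
  have h2 := g.le_of_opNorm_le (hf _ hFS) (∑ i ∈ E, a i • (v i - z))
  rw [div_le_iff₀ (by positivity)]
  linarith

theorem not_isSpreadingModel_of_mem_weakClosure {S : Set (Finset ℕ+)} (hS : IsHereditary S)
    (hsp : IsSpreading S) (hc : IsCompactFamily S) {K : Set X}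
    (hK : ∀ x : ℕ+ → X, (∀ n, x n ∈ K) → ∃ k : ℕ+ → ℕ+, StrictMono k ∧ ∃ z,
      WeaklyConvergesTo 𝕜 (fun n => x (k n)) z ∧ ¬ IsSpreadingModel 𝕜 S fun n => x (k n) - z)
    {x : ℕ+ → X} {y : X} (hx : ∀ n, x n ∈ weakClosure 𝕜 K) (hxy : WeaklyConvergesTo 𝕜 x y) :
    ¬ IsSpreadingModel 𝕜 S fun n => x n - y := by
  rintro ⟨δ, hδ, h⟩
  let U : Ultrafilter ℕ+ := Ultrafilter.of atTop
  have hU : (U : Filter ℕ+) ≤ atTop := Ultrafilter.of_le atTop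
  obtain ⟨f, hf⟩ := exists_coherent_functionals hS hc
    (fun E hE => exists_dual_eq_one hδ (h E hE)) U hU
  obtain ⟨n, w, hn, hw, hfw⟩ := exists_almost_biorthogonal hS hU hx hxy
    (fun s hs => (hf s hs).2.1) (fun s hs => (hf s hs).2.2) (ε := 1 / 16) (by norm_num)
  obtain ⟨k, hk, z, hz, hnot⟩ := hK (fun i => w i.natPred) fun i => hw _
  refine hnot (IsSpreadingModel.of_almost_biorthogonal hS hsp (one_div_pos.2 hδ)
    (fun s hs => (hf s hs).1) (e := fun i => n (k i).natPred) (y := y)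
    (hn.comp (PNat.natPred_strictMono.comp hk)) (fun E hE hEe j => ?_) hz)
  exact hfw E hE (hEe.trans (Set.range_comp_subset_range (fun i => (k i).natPred) n)) _

end SpreadingModels

/-! ### The norm case and the proof of the equivalence. -/

section Compactness

variable {𝕜 : Type*} [RCLike 𝕜] {X : Type*} [NormedAddCommGroup X] [NormedSpace 𝕜 X]

theorem tendsto_toWeakSpace {x : ℕ+ → X} {y : X} (h : Tendsto x atTop (𝓝 y)) :
    WeaklyConvergesTo 𝕜 x y :=
  weaklyConvergesTo_iff.2 fun f => (f.continuous.tendsto y).comp h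

/-- A norm compact set is weakly compact, hence weakly closed. -/
theorem weakClosure_subset_closure_of_isCompact {K : Set X} (hK : IsCompact (closure K)) :
    weakClosure 𝕜 K ⊆ closure K := by
  intro x hx
  have hc : IsCompact (toWeakSpace 𝕜 X '' closure K) :=
    hK.image (toWeakSpaceCLM 𝕜 X).continuous
  have : toWeakSpace 𝕜 X x ∈ toWeakSpace 𝕜 X '' closure K :=
    closure_minimal (Set.image_mono subset_closure) hc.isClosed hx
  obtain ⟨z, hz, hzx⟩ := this
  rwa [← (toWeakSpace 𝕜 X).injective hzx]

theorem isCompact_closure_of_subseq {K : Set X}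
    (hK : ∀ x : ℕ+ → X, (∀ n, x n ∈ K) → ∃ k : ℕ+ → ℕ+, StrictMono k ∧
      ∃ y, Tendsto (fun n => x (k n)) atTop (𝓝 y)) : IsCompact (closure K) := by
  refine IsSeqCompact.isCompact fun x hx => ?_
  have hex : ∀ n, ∃ w ∈ K, dist (x n) w < 1 / ((n : ℝ) + 1) := fun n =>
    Metric.mem_closure_iff.1 (hx n) _ Nat.one_div_pos_of_nat
  choose w hwK hw using hex
  obtain ⟨k, hk, y, hy⟩ := hK (fun n => w n.natPred) fun n => hwK _
  have hφ : StrictMono fun n : ℕ => (k n.succPNat).natPred :=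
    PNat.natPred_strictMono.comp (hk.comp Nat.succPNat_strictMono)
  have hwy : Tendsto (fun n : ℕ => w (k n.succPNat).natPred) atTop (𝓝 y) :=
    hy.comp OrderIso.pnatIsoNat.symm.tendsto_atTop
  refine ⟨y, mem_closure_of_tendsto hwy (Eventually.of_forall fun n => hwK _), _, hφ, ?_⟩
  refine (tendsto_iff_of_dist ?_).2 hwy
  exact squeeze_zero (fun _ => dist_nonneg) (fun n => (hw _).le)
    (tendsto_one_div_add_atTop_nhds_zero_nat.comp hφ.tendsto_atTop)

theorem IsXiWeaklyPrecompact.zero {c : Ordinal.{0} → ℕ+ → Ordinal.{0}} {K : Set X}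
    (h : IsXiWeaklyPrecompact 𝕜 c 0 K) : IsXiWeaklyCompact 𝕜 c 0 (weakClosure 𝕜 K) := by
  have hc : IsCompact (closure K) := isCompact_closure_of_subseq fun x hx => by
    obtain ⟨k, hk, y, hy⟩ := h x hx
    exact ⟨k, hk, y, hy.1 rfl⟩
  intro x hx
  obtain ⟨y, -, φ, hφ, hy⟩ := hc.isSeqCompact fun n : ℕ =>
    weakClosure_subset_closure_of_isCompact hc (hx n.succPNat)
  have hk : StrictMono fun n : ℕ+ => (φ n.natPred).succPNat :=
    Nat.succPNat_strictMono.comp (hφ.comp PNat.natPred_strictMono)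
  have hky : Tendsto (fun n : ℕ+ => x (φ n.natPred).succPNat) atTop (𝓝 y) :=
    hy.comp OrderIso.pnatIsoNat.tendsto_atTop
  exact ⟨_, hk, y, mem_weakClosure_of_weaklyConvergesTo (fun n => hx _) (tendsto_toWeakSpace hky),
    fun _ => hky, fun h0 => absurd h0 (lt_irrefl _), fun h0 => absurd h0 (lt_irrefl _)⟩

theorem WeaklyConvergesTo.comp {x : ℕ+ → X} {y : X} (h : WeaklyConvergesTo 𝕜 x y) {k : ℕ+ → ℕ+}
    (hk : StrictMono k) : WeaklyConvergesTo 𝕜 (fun n => x (k n)) y :=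
  weaklyConvergesTo_iff.2 fun f =>
    (weaklyConvergesTo_iff.1 h f).comp (PNat.tendsto_atTop_of_strictMono hk)

theorem IsXiWeaklyPrecompact.isXiWeaklyCompact_weakClosure
    {c : Ordinal.{0} → ℕ+ → Ordinal.{0}} (hc : IsFundamentalChoice c) {ξ : Ordinal.{0}}
    {K : Set X} (h : IsXiWeaklyPrecompact 𝕜 c ξ K) :
    IsXiWeaklyCompact 𝕜 c ξ (weakClosure 𝕜 K) := by
  rcases eq_zero_or_pos ξ with rfl | hpos
  · exact h.zero
  intro x hx
  have hcc : IsRelativelyWeaklyCountablyCompact 𝕜 K :=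
    isRelativelyWeaklyCountablyCompact_of_subseq fun w hw => by
      obtain ⟨k, hk, y, hy⟩ := h w hw
      exact ⟨k, hk, y, hy.2.1 hpos⟩
  obtain ⟨k, hk, y, hy⟩ := hcc.exists_subseq hx
  refine ⟨k, hk, y, mem_weakClosure_of_weaklyConvergesTo (fun n => hx _) hy,
    fun h0 => absurd h0 hpos.ne', fun _ => hy, fun _ hlt j hj => ?_⟩
  obtain ⟨h1, h2, h3⟩ := schreier_regular hc ξ hlt
  -- The subsequence along `j` again lies in the weak closure and converges weakly to `y`; from `K`,
  -- only the failure for the extracted sequence itself (`id`) is needed.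
  refine not_isSpreadingModel_of_mem_weakClosure h1 h2 h3 (fun w hw => ?_)
    (fun n => hx (k (j n))) (hy.comp hj)
  obtain ⟨i, hi, z, hz⟩ := h w hw
  exact ⟨i, hi, z, hz.2.1 hpos, hz.2.2 hpos hlt id strictMono_id⟩

theorem IsXiWeaklyCompact.isXiWeaklyPrecompact {c : Ordinal.{0} → ℕ+ → Ordinal.{0}}
    {ξ : Ordinal.{0}} {K : Set X} (h : IsXiWeaklyCompact 𝕜 c ξ (weakClosure 𝕜 K)) :
    IsXiWeaklyPrecompact 𝕜 c ξ K := by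
  intro x hx
  obtain ⟨k, hk, y, -, hy⟩ := h x fun n => subset_weakClosure K (hx n)
  exact ⟨k, hk, y, hy⟩

end Compactness

end XiWeak

theorem proposition3p2 {𝕜 : Type*} [RCLike 𝕜] {X : Type*} [NormedAddCommGroup X]
    [NormedSpace 𝕜 X] [CompleteSpace X]
    (c : Ordinal.{0} → ℕ+ → Ordinal.{0}) (hc : XiWeak.IsFundamentalChoice c)
    (ξ : Ordinal.{0}) (hξ : ξ ≤ ω₁) (K : Set X) :
    XiWeak.IsXiWeaklyPrecompact 𝕜 c ξ K ↔
      XiWeak.IsXiWeaklyCompact 𝕜 c ξ (XiWeak.weakClosure 𝕜 K) :=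
  ⟨fun h => h.isXiWeaklyCompact_weakClosure hc, fun h => h.isXiWeaklyPrecompact⟩
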